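/- Let $D$ be a division ring and let $(G,<)$ be an ordered group, i.e. a (not necessarily abelian) group, written additively, with a total order invariant under left and right translations. Let $G_\infty=G\cup\{\infty\}$, where $x+\infty=\infty+x=\infty$ for all $x\in G_\infty$ and $g<\infty$ for all $g\in G$. Let $\upsilon\colon D\to G_\infty$ be a surjective valuation, i.e. a surjective map such that for all $x,y\in D$: $\upsilon(x)=\infty$ if and only if $x=0$; $\upsilon(x+y)\ge\min\{\upsilon(x),\upsilon(y)\}$; and $\upsilon(xy)=\upsilon(x)+\upsilon(y)$. Suppose that $g,h\in G$ are such that the submonoid of $G$ generated by $\{g,h\}$ is free of rank two on $\{g,h\}$, i.e. distinct words in two letters take distinct values at $(g,h)$. Then for every subfield $k$ of the center of $D$, the division ring $D$ contains a free group $k$-algebra of rank two: there is an injective $k$-algebra homomorphism $k[F_2]\to D$, where $k[F_2]$ is the group algebra over $k$ of the free group $F_2$ on two letters. -/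

import Mathlib

/-- A valuation on a (not necessarily commutative) ring `R` with values in a totally ordered,
not necessarily abelian, additively written group `G`: a map `R → G ∪ {∞}`, where `∞` is the top
element of `WithTop G`, larger than every element of `G` and absorbing for addition. -/
structure RingValuation (R G : Type*) [Ring R] [AddGroup G] [LinearOrder G] where
  /-- The underlying map to `G ∪ {∞}`. -/
  toFun : R → WithTop G
  map_eq_top_iff : ∀ x : R, toFun x = ⊤ ↔ x = 0
  min_le_map_add : ∀ x y : R, min (toFun x) (toFun y) ≤ toFun (x + y)
  map_mul : ∀ x y : R, toFun (x * y) = toFun x + toFun y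

/-- The submonoid generated by `g` and `h` is the free monoid on `{g, h}` (of rank two): distinct
words in two letters take distinct values at `(g, h)`. -/
def FreelyGenerateFreeMonoid {G : Type*} [AddMonoid G] (g h : G) : Prop :=
  Function.Injective (FreeAddMonoid.lift ![g, h] : FreeAddMonoid (Fin 2) →+ G)

/-- The `k`-algebra `A` contains a free group `k`-algebra (of rank two): the group algebra over `k`
of the free group on two letters embeds in `A` as a `k`-algebra. -/
def ContainsFreeGroupAlgebra (k A : Type*) [Field k] [Ring A] [Algebra k A] : Prop :=
  ∃ φ : MonoidAlgebra k (FreeGroup (Fin 2)) →ₐ[k] A, Function.Injective φ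

/-! The free group is generated by units `1 + a s`, where the `a s` have positive values γ s that
still generate a free monoid. Such γ come from `g`, `h` by passing twice to the pair x + y, y + x.
These two sums are conjugate, so they have the same sign, and a change of sign makes both positive;
the second pass gives μ ≤ γ s ≤ 2μ for some μ > 0.

Substituting `1 + a s` in an element f of the group algebra yields its Magnus expansion in the
monomials of `a`, whose coefficients are augmentations of iterated Fox derivatives. For integral
coefficients, truncating at length n costs an error of value at least nμ
(`exists_nsmul_le_map_evalUnits_sub`). Scalars have central values, and central shifts cannot
identify the values of two distinct words (`eq_of_central_add_wordSum`), so the terms of the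
truncation do not cancel. A word l whose coefficient has value 0 bounds the value of the truncation
by 2|l|μ, which is below the error once n = 2|l| + 1; hence f does not evaluate to 0.

Such an l exists once f is scaled to be integral with one coefficient of value 0: Magnus expansion
is injective over every commutative ring, in particular modulo the ideal of elements of positive
value (`coeff_mem_of_magnusCoeff_mem`). -/

namespace FoxCalculus

/-! ### Fox derivatives and Magnus coefficients -/

section Fox

variable {R α : Type*} [CommRing R] [DecidableEq α]

/-- The affine permutation `m ↦ t * m + δ` of the group algebra of the free group attached to the
generator `t`, where `δ` is `1` if `t = s` and `0` otherwise. -/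
noncomputable def foxPerm (R : Type*) [CommRing R] (s t : α) :
    Equiv.Perm (MonoidAlgebra R (FreeGroup α)) where
  toFun m := MonoidAlgebra.of R _ (FreeGroup.of t) * m + if t = s then 1 else 0
  invFun m := MonoidAlgebra.of R _ (FreeGroup.of t)⁻¹ * (m - if t = s then 1 else 0)
  left_inv m := by
    simp only [add_sub_cancel_right]
    rw [← mul_assoc, ← map_mul, inv_mul_cancel, map_one, one_mul]
  right_inv m := by
    beta_reduce
    rw [← mul_assoc, ← map_mul, mul_inv_cancel, map_one, one_mul, sub_add_cancel]

/-- The left Fox derivative with respect to the generator `s` of an element of the free group. -/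
noncomputable def foxElement (R : Type*) [CommRing R] (s : α) (w : FreeGroup α) :
    MonoidAlgebra R (FreeGroup α) :=
  FreeGroup.lift (foxPerm R s) w 0

/-- The Fox derivative is the translation part of an affine action of the free group, so its product
rule is composition of affine maps. -/
lemma lift_foxPerm_apply (s : α) (w : FreeGroup α) (m : MonoidAlgebra R (FreeGroup α)) :
    FreeGroup.lift (foxPerm R s) w m = MonoidAlgebra.of R _ w * m + foxElement R s w := by
  unfold foxElement
  induction w using FreeGroup.induction_on generalizing m with
  | C1 => rw [map_one, map_one]; simp only [Equiv.Perm.one_apply, one_mul, add_zero]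
  | of t => simp only [FreeGroup.lift_apply_of, foxPerm, Equiv.coe_fn_mk, mul_zero, zero_add]
  | inv_of t _ =>
    rw [map_inv, FreeGroup.lift_apply_of, Equiv.Perm.inv_def]
    simp only [foxPerm, Equiv.coe_fn_symm_mk]
    rw [mul_sub, zero_sub, mul_neg, sub_eq_add_neg]
  | mul x y hx hy =>
    rw [map_mul, map_mul, Equiv.Perm.mul_apply, Equiv.Perm.mul_apply, hy, hx,
      hx (FreeGroup.lift (foxPerm R s) y 0), mul_add, ← mul_assoc, add_assoc]

@[simp] lemma foxElement_one (s : α) : foxElement R s 1 = 0 := by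
  simp [foxElement]

lemma foxElement_mul (s : α) (u w : FreeGroup α) :
    foxElement R s (u * w) = MonoidAlgebra.of R _ u * foxElement R s w + foxElement R s u := by
  rw [foxElement, map_mul, Equiv.Perm.mul_apply, lift_foxPerm_apply]
  rfl

lemma foxElement_of (s t : α) : foxElement R s (FreeGroup.of t) = if t = s then 1 else 0 := by
  simp only [foxElement, FreeGroup.lift_apply_of, foxPerm, Equiv.coe_fn_mk, mul_zero, zero_add]

lemma foxElement_inv (s : α) (w : FreeGroup α) :
    foxElement R s w⁻¹ = - (MonoidAlgebra.of R _ w⁻¹ * foxElement R s w) := by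
  have h := foxElement_mul (R := R) s w⁻¹ w
  rw [inv_mul_cancel, foxElement_one] at h
  exact (neg_eq_of_add_eq_zero_right h.symm).symm

lemma map_foxElement {S : Type*} [CommRing S] (π : R →+* S) (s : α) (w : FreeGroup α) :
    MonoidAlgebra.mapRingHom _ π (foxElement R s w) = foxElement S s w := by
  have hof (u : FreeGroup α) : MonoidAlgebra.mapRingHom _ π (MonoidAlgebra.of R _ u) =
      MonoidAlgebra.of S _ u := by simp
  have h1 (t : α) : MonoidAlgebra.mapRingHom _ π (foxElement R s (FreeGroup.of t)) =
      foxElement S s (FreeGroup.of t) := by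
    rw [foxElement_of, foxElement_of]; split_ifs <;> simp
  induction w using FreeGroup.induction_on with
  | C1 => simp
  | of t => exact h1 t
  | inv_of t _ => rw [foxElement_inv, foxElement_inv, map_neg, map_mul, hof, h1]
  | mul x y hx hy => rw [foxElement_mul, foxElement_mul, map_add, map_mul, hof, hx, hy]

/-- The left Fox derivative with respect to the generator `s` on the group algebra of the free
group. -/
noncomputable def foxDeriv (R : Type*) [CommRing R] (s : α) :
    MonoidAlgebra R (FreeGroup α) →ₗ[R] MonoidAlgebra R (FreeGroup α) :=
  Finsupp.linearCombination R (foxElement R s) ∘ₗ (MonoidAlgebra.coeffLinearEquiv R).toLinearMap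

lemma foxDeriv_apply (s : α) (f : MonoidAlgebra R (FreeGroup α)) :
    foxDeriv R s f = f.coeff.sum fun w r => r • foxElement R s w := rfl

@[simp] lemma foxDeriv_of (s : α) (w : FreeGroup α) :
    foxDeriv R s (MonoidAlgebra.of R _ w) = foxElement R s w := by
  simp [foxDeriv_apply]

lemma coeff_foxDeriv (s : α) (f : MonoidAlgebra R (FreeGroup α)) (p : FreeGroup α) :
    (foxDeriv R s f).coeff p = f.coeff.sum fun w r => r * (foxElement R s w).coeff p := by
  rw [foxDeriv_apply, Finsupp.sum, Finsupp.sum, MonoidAlgebra.coeff_sum, Finsupp.finsetSum_apply]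
  rfl

lemma foxDeriv_mul_of (s : α) (f : MonoidAlgebra R (FreeGroup α)) (w : FreeGroup α) :
    foxDeriv R s (f * MonoidAlgebra.of R _ w) = f * foxElement R s w + foxDeriv R s f := by
  induction f using MonoidAlgebra.induction_on with
  | of u => rw [← map_mul, foxDeriv_of, foxElement_mul, foxDeriv_of]
  | add x y hx hy => rw [add_mul, map_add, hx, hy, map_add, add_mul]; abel
  | smul r x hx => rw [smul_mul_assoc, map_smul, hx, map_smul, smul_add, smul_mul_assoc]

lemma map_foxDeriv {S : Type*} [CommRing S] (π : R →+* S) (s : α)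
    (f : MonoidAlgebra R (FreeGroup α)) :
    MonoidAlgebra.mapRingHom _ π (foxDeriv R s f) =
      foxDeriv S s (MonoidAlgebra.mapRingHom _ π f) := by
  have key (r : R) (x : MonoidAlgebra R (FreeGroup α)) :
      MonoidAlgebra.mapRingHom _ π (r • x) = π r • MonoidAlgebra.mapRingHom _ π x := by
    ext; simp
  induction f using MonoidAlgebra.induction_on with
  | of u =>
    rw [foxDeriv_of, map_foxElement, MonoidAlgebra.of_apply, MonoidAlgebra.mapRingHom_single,
      map_one, ← MonoidAlgebra.of_apply, foxDeriv_of]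
  | add x y hx hy => rw [map_add, map_add, hx, hy, map_add, map_add]
  | smul r x hx => rw [map_smul, key, hx, key, map_smul]

/-- The Magnus coefficient at a word `l`: the augmentation of the iterated Fox derivative
along `l`. -/
noncomputable def magnusCoeff (R : Type*) [CommRing R] :
    List α → MonoidAlgebra R (FreeGroup α) →ₗ[R] R
  | [] => (MonoidAlgebra.lift R R (FreeGroup α) 1).toLinearMap
  | s :: l => magnusCoeff R l ∘ₗ foxDeriv R s

lemma magnusCoeff_nil (f : MonoidAlgebra R (FreeGroup α)) :
    magnusCoeff R [] f = MonoidAlgebra.lift R R (FreeGroup α) 1 f := rfl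

lemma magnusCoeff_cons (s : α) (l : List α) (f : MonoidAlgebra R (FreeGroup α)) :
    magnusCoeff R (s :: l) f = magnusCoeff R l (foxDeriv R s f) := rfl

lemma map_magnusCoeff {S : Type*} [CommRing S] (π : R →+* S) (l : List α)
    (f : MonoidAlgebra R (FreeGroup α)) :
    π (magnusCoeff R l f) = magnusCoeff S l (MonoidAlgebra.mapRingHom _ π f) := by
  induction l generalizing f with
  | nil =>
    rw [magnusCoeff_nil, magnusCoeff_nil]
    induction f using MonoidAlgebra.induction_on with
    | of u => simp
    | add x y hx hy => rw [map_add, map_add, hx, hy, map_add, map_add]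
    | smul r x hx =>
      have key : MonoidAlgebra.mapRingHom _ π (r • x) = π r • MonoidAlgebra.mapRingHom _ π x := by
        ext; simp
      rw [key, map_smul (MonoidAlgebra.lift R R (FreeGroup α) 1), smul_eq_mul, map_mul,
        hx, map_smul (MonoidAlgebra.lift S S (FreeGroup α) 1), smul_eq_mul]
  | cons s l ih => rw [magnusCoeff_cons, magnusCoeff_cons, ih, map_foxDeriv]

/-- Serves the case of a word ending in an inverse generator, where the derivative must be shifted
on the right before induction applies. -/
lemma magnusCoeff_mul_of (f : MonoidAlgebra R (FreeGroup α)) (hf : ∀ l, magnusCoeff R l f = 0)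
    (t : α) (l : List α) : magnusCoeff R l (f * MonoidAlgebra.of R _ (FreeGroup.of t)) = 0 := by
  cases l with
  | nil =>
    have := hf []
    rw [magnusCoeff_nil] at this ⊢
    rw [map_mul, this, zero_mul]
  | cons s l =>
    rw [magnusCoeff_cons, foxDeriv_mul_of, map_add, ← magnusCoeff_cons, hf, add_zero,
      foxElement_of]
    split_ifs <;> simp [hf]

end Fox

end FoxCalculus

namespace FoxCalculus

/-! ### Injectivity of the Magnus expansion over a commutative ring -/

section Injectivity

lemma mk_concat_true {α : Type*} (L : List (α × Bool)) (t : α) :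
    FreeGroup.mk (L ++ [(t, true)]) = FreeGroup.mk L * FreeGroup.of t := by
  rw [← FreeGroup.mul_mk]; rfl

lemma mk_concat_false {α : Type*} (L : List (α × Bool)) (t : α) :
    FreeGroup.mk (L ++ [(t, false)]) = FreeGroup.mk L * (FreeGroup.of t)⁻¹ := by
  rw [← FreeGroup.mul_mk]; rfl

variable {R α : Type*} [CommRing R] [DecidableEq α]

lemma toWord_mk_of_isPrefix {w : FreeGroup α} {L : List (α × Bool)} (h : L <+: w.toWord) :
    (FreeGroup.mk L).toWord = L := by
  rw [FreeGroup.toWord_mk]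
  exact (FreeGroup.isReduced_toWord.infix h.isInfix).reduce_eq

/-- Appending `s` to `L` adds the term `L` to the derivative, and appending the inverse of `s`
subtracts the term `L * s⁻¹`; other letters add nothing. -/
lemma exists_isPrefix_of_coeff_foxElement_mk_ne_zero {s : α} {p : FreeGroup α}
    (L : List (α × Bool)) (h : (foxElement R s (FreeGroup.mk L)).coeff p ≠ 0) :
    (∃ L', L' <+: L ∧ FreeGroup.mk L' = p) ∧
      ∃ L', L' <+: L ∧ FreeGroup.mk L' = p * FreeGroup.of s := by
  induction L using List.reverseRecOn with
  | nil => exact absurd (by rw [← FreeGroup.one_eq_mk, foxElement_one]; rfl) h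
  | append_singleton L x ih =>
    by_cases h0 : (foxElement R s (FreeGroup.mk L)).coeff p = 0
    · obtain ⟨t, b⟩ := x
      cases b with
      | true =>
        rw [mk_concat_true, foxElement_mul, foxElement_of, MonoidAlgebra.coeff_add,
          Finsupp.add_apply, h0, add_zero] at h
        split_ifs at h with hts
        · subst hts
          have hp : FreeGroup.mk L = p := by
            by_contra hne
            simp [hne] at h
          exact ⟨⟨L, List.prefix_append _ _, hp⟩, _, List.prefix_rfl, by rw [mk_concat_true, hp]⟩
        · simp at h
      | false =>
        rw [mk_concat_false, foxElement_mul, foxElement_inv, foxElement_of,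
          MonoidAlgebra.coeff_add, Finsupp.add_apply, h0, add_zero] at h
        split_ifs at h with hts
        · subst hts
          have hp : FreeGroup.mk L * (FreeGroup.of t)⁻¹ = p := by
            by_contra hne
            rw [mul_one, mul_neg, ← map_mul] at h
            simp [hne] at h
          exact ⟨⟨_, List.prefix_rfl, by rw [mk_concat_false, hp]⟩, L, List.prefix_append _ _,
            by rw [← hp, inv_mul_cancel_right]⟩
        · simp at h
    · obtain ⟨⟨L₁, h₁, e₁⟩, L₂, h₂, e₂⟩ := ih h0
      exact ⟨⟨L₁, h₁.trans (List.prefix_append _ _), e₁⟩,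
        L₂, h₂.trans (List.prefix_append _ _), e₂⟩

lemma toWord_isPrefix_of_coeff_foxElement_ne_zero {s : α} {p w : FreeGroup α}
    (h : (foxElement R s w).coeff p ≠ 0) :
    p.toWord <+: w.toWord ∧ (p * FreeGroup.of s).toWord <+: w.toWord := by
  rw [← FreeGroup.mk_toWord (x := w)] at h
  obtain ⟨⟨L₁, h₁, rfl⟩, L₂, h₂, e₂⟩ := exists_isPrefix_of_coeff_foxElement_mk_ne_zero _ h
  rw [← e₂, toWord_mk_of_isPrefix h₁, toWord_mk_of_isPrefix h₂]
  exact ⟨h₁, h₂⟩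

lemma coeff_foxDeriv_eq_zero {T : Finset (FreeGroup α)}
    (hT : ∀ u ∈ T, ∀ p : FreeGroup α, p.toWord <+: u.toWord → p ∈ T)
    {f : MonoidAlgebra R (FreeGroup α)} (hf : ∀ u ∉ T, f.coeff u = 0) (s : α) {p : FreeGroup α}
    (hp : p ∉ T ∨ p * FreeGroup.of s ∉ T) : (foxDeriv R s f).coeff p = 0 := by
  rw [coeff_foxDeriv]
  refine Finset.sum_eq_zero fun u _ => ?_
  by_cases hu : u ∈ T
  · by_contra hne
    have := toWord_isPrefix_of_coeff_foxElement_ne_zero (right_ne_zero_of_mul hne)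
    exact hp.elim (fun h => h (hT u hu _ this.1)) fun h => h (hT u hu _ this.2)
  · beta_reduce; rw [hf u hu, zero_mul]

lemma coeff_foxDeriv_eq_mul {T : Finset (FreeGroup α)} {w : FreeGroup α}
    (hw : ∀ u ∈ T, w.toWord <+: u.toWord → u = w)
    {f : MonoidAlgebra R (FreeGroup α)} (hf : ∀ u ∉ T, f.coeff u = 0) (s : α) {p : FreeGroup α}
    (hp : p = w ∨ p * FreeGroup.of s = w) :
    (foxDeriv R s f).coeff p = f.coeff w * (foxElement R s w).coeff p := by
  rw [coeff_foxDeriv, Finsupp.sum_eq_single w]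
  · intro u hu huw
    by_contra hne
    have huT : u ∈ T := by
      by_contra h
      exact left_ne_zero_of_mul hne (hf u h)
    have := toWord_isPrefix_of_coeff_foxElement_ne_zero (right_ne_zero_of_mul hne)
    rcases hp with rfl | hp
    · exact huw (hw u huT this.1)
    · exact huw (hw u huT (hp ▸ this.2))
  · intro _; rw [zero_mul]

/-- Induction on the prefix-closed set `T`, removing a longest word `w`. If `w` ends in `s`, the
derivative along `s` lives on `T` without `w`, hence vanishes, and it carries the coefficient of `w`
at `w * s⁻¹`. If `w` ends in the inverse of `s`, the same holds for the derivative times `s`, with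
minus that coefficient at `w * s`. -/
lemma eq_zero_of_magnusCoeff_of_support (T : Finset (FreeGroup α))
    (hT : ∀ u ∈ T, ∀ p : FreeGroup α, p.toWord <+: u.toWord → p ∈ T)
    (f : MonoidAlgebra R (FreeGroup α)) (hf : ∀ u ∉ T, f.coeff u = 0)
    (hm : ∀ l, magnusCoeff R l f = 0) : f = 0 := by
  induction T using Finset.strongInduction generalizing f with
  | H T ih =>
    rcases T.eq_empty_or_nonempty with rfl | hne
    · ext u; exact hf u (Finset.notMem_empty u)
    obtain ⟨w, hwT, hmax⟩ := T.exists_max_image (fun u => u.toWord.length) hne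
    have hw : ∀ u ∈ T, w.toWord <+: u.toWord → u = w := fun u hu h =>
      (FreeGroup.toWord_injective (h.eq_of_length_le (hmax u hu))).symm
    have ih' (f' : MonoidAlgebra R (FreeGroup α)) (hf' : ∀ u ∉ T, f'.coeff u = 0)
        (hw' : f'.coeff w = 0) (hm' : ∀ l, magnusCoeff R l f' = 0) : f' = 0 := by
      refine ih (T.erase w) (Finset.erase_ssubset hwT) (fun u hu p hp => ?_) f' (fun u hu => ?_) hm'
      · have huT := Finset.mem_of_mem_erase hu
        refine Finset.mem_erase.2 ⟨?_, hT u huT p hp⟩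
        rintro rfl
        exact Finset.ne_of_mem_erase hu (hw u huT hp)
      · by_cases huw : u = w
        · rw [huw, hw']
        · exact hf' u fun h => hu (Finset.mem_erase.2 ⟨huw, h⟩)
    suffices h : f.coeff w = 0 from ih' f hf h hm
    rcases List.eq_nil_or_concat' w.toWord with hnil | ⟨L, ⟨s, b⟩, hL⟩
    · have hw1 : w = 1 := FreeGroup.toWord_eq_nil_iff.1 hnil
      have hfe : f = MonoidAlgebra.single w (f.coeff w) := by
        ext u
        by_cases hu : u = w
        · simp [hu]
        · have : u ∉ T := fun h => hu <| hw u h (hnil ▸ List.nil_prefix)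
          simp [hf u this, Ne.symm hu]
      have h0 := hm []
      rw [magnusCoeff_nil, hfe, MonoidAlgebra.lift_single] at h0
      simpa using h0
    · have hLw : L <+: w.toWord := hL ▸ List.prefix_append _ _
      have hLword := toWord_mk_of_isPrefix hLw
      have hlen : w.toWord.length = L.length + 1 := by rw [hL]; simp
      have hD : ∀ l, magnusCoeff R l (foxDeriv R s f) = 0 := fun l => hm (s :: l)
      have hnot : ¬ w.toWord <+: L := fun h => by have := h.length_le; omega
      -- Repeating the last letter of `w` keeps the word reduced and makes it longer than any word
      -- in `T`.
      have hlong (c : Bool) (hc : b = c) : FreeGroup.mk (w.toWord ++ [(s, c)]) ∉ T := by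
        subst hc
        intro h
        have hred : FreeGroup.IsReduced (w.toWord ++ [(s, b)]) := by
          rw [hL]
          refine FreeGroup.IsReduced.append_overlap ?_ ?_ (by simp)
          · rw [← hL]; exact FreeGroup.isReduced_toWord
          · simp [FreeGroup.IsReduced]
        have := hmax _ h
        rw [FreeGroup.toWord_mk, hred.reduce_eq] at this
        simp at this
      cases b with
      | true =>
        have hwL : w = FreeGroup.mk L * FreeGroup.of s := by
          rw [← mk_concat_true, ← hL, FreeGroup.mk_toWord]
        have h1 : w * FreeGroup.of s ∉ T := by
          have := hlong true rfl
          rwa [mk_concat_true, FreeGroup.mk_toWord] at this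
        have h0 := ih' (foxDeriv R s f) (fun u hu => coeff_foxDeriv_eq_zero hT hf s (Or.inl hu))
          (coeff_foxDeriv_eq_zero hT hf s (Or.inr h1)) hD
        have h2 := coeff_foxDeriv_eq_mul hw hf s (p := FreeGroup.mk L) (Or.inr hwL.symm)
        have h3 : (foxElement R s (FreeGroup.mk L)).coeff (FreeGroup.mk L) = 0 := by
          by_contra hne
          have := (toWord_isPrefix_of_coeff_foxElement_ne_zero hne).2
          rw [← hwL, hLword] at this
          exact hnot this
        have h4 : (foxElement R s w).coeff (FreeGroup.mk L) = 1 := by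
          rw [hwL, foxElement_mul, foxElement_of, if_pos rfl, MonoidAlgebra.coeff_add,
            Finsupp.add_apply, h3]
          simp
        rw [h0, h4, mul_one] at h2
        exact h2.symm
      | false =>
        have hwL : w = FreeGroup.mk L * (FreeGroup.of s)⁻¹ := by
          rw [← mk_concat_false, ← hL, FreeGroup.mk_toWord]
        have h1 : w * (FreeGroup.of s)⁻¹ ∉ T := by
          have := hlong false rfl
          rwa [mk_concat_false, FreeGroup.mk_toWord] at this
        have hcoeff (u : FreeGroup α) :
            (foxDeriv R s f * MonoidAlgebra.of R _ (FreeGroup.of s)).coeff u =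
              (foxDeriv R s f).coeff (u * (FreeGroup.of s)⁻¹) := by
          rw [MonoidAlgebra.of_apply, MonoidAlgebra.coeff_mul_single_apply, mul_one]
        have h0 := ih' (foxDeriv R s f * MonoidAlgebra.of R _ (FreeGroup.of s))
          (fun u hu => by
            rw [hcoeff]
            exact coeff_foxDeriv_eq_zero hT hf s (Or.inr (by rwa [inv_mul_cancel_right])))
          (by rw [hcoeff]; exact coeff_foxDeriv_eq_zero hT hf s (Or.inl h1))
          (fun l => magnusCoeff_mul_of _ hD s l)
        have h2 := coeff_foxDeriv_eq_mul hw hf s (p := w) (Or.inl rfl)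
        have h3 : (foxElement R s (FreeGroup.mk L)).coeff w = 0 := by
          by_contra hne
          have := (toWord_isPrefix_of_coeff_foxElement_ne_zero hne).1
          rw [hLword] at this
          exact hnot this
        have h4 : (foxElement R s w).coeff w = -1 := by
          conv_lhs => rw [hwL]
          rw [foxElement_mul, foxElement_inv, foxElement_of, if_pos rfl, MonoidAlgebra.coeff_add,
            Finsupp.add_apply, ← hwL, h3, mul_one, mul_neg, ← map_mul, ← hwL]
          simp
        have h5 := hcoeff (w * FreeGroup.of s)
        rw [h0, mul_inv_cancel_right, h2, h4, mul_neg, mul_one] at h5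
        exact neg_eq_zero.1 h5.symm

/-- The group algebra of a free group over a commutative ring embeds in the ring of power series
in noncommuting variables: an element is determined by its Magnus coefficients. -/
theorem eq_zero_of_magnusCoeff (f : MonoidAlgebra R (FreeGroup α))
    (hm : ∀ l, magnusCoeff R l f = 0) : f = 0 := by
  let T : Finset (FreeGroup α) :=
    f.coeff.support.biUnion fun w => (w.toWord.inits.map FreeGroup.mk).toFinset
  have hmem (u : FreeGroup α) :
      u ∈ T ↔ ∃ w ∈ f.coeff.support, u.toWord <+: w.toWord := by
    simp only [T, Finset.mem_biUnion, List.mem_toFinset, List.mem_map, List.mem_inits]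
    refine exists_congr fun w => and_congr_right fun _ => ⟨?_, fun h => ⟨_, h, FreeGroup.mk_toWord⟩⟩
    rintro ⟨L, hL, rfl⟩
    rwa [toWord_mk_of_isPrefix hL]
  refine eq_zero_of_magnusCoeff_of_support T (fun u hu p hp => ?_) f (fun u hu => ?_) hm
  · obtain ⟨w, hw, h⟩ := (hmem u).1 hu
    exact (hmem p).2 ⟨w, hw, hp.trans h⟩
  · by_contra h
    exact hu ((hmem u).2 ⟨u, Finsupp.mem_support_iff.2 h, List.prefix_rfl⟩)

/-- An element of the group algebra of a free group whose Magnus coefficients all lie in an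
ideal has all its coefficients in this ideal. -/
theorem coeff_mem_of_magnusCoeff_mem (I : Ideal R) (f : MonoidAlgebra R (FreeGroup α))
    (hm : ∀ l, magnusCoeff R l f ∈ I) (w : FreeGroup α) : f.coeff w ∈ I := by
  have h := eq_zero_of_magnusCoeff (MonoidAlgebra.mapRingHom _ (Ideal.Quotient.mk I) f) fun l => by
    rw [← map_magnusCoeff]
    exact Ideal.Quotient.eq_zero_iff_mem.2 (hm l)
  have h' := congrArg (fun x => x.coeff w) h
  exact Ideal.Quotient.eq_zero_iff_mem.1 (by simpa using h')

end Injectivity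

end FoxCalculus

/-! ### Evaluation at units and the fundamental formula -/

namespace FoxCalculus

variable {R α A : Type*} [CommRing R] [Ring A] [Algebra R A]

/-- The homomorphism from the group algebra of the free group induced by a family of units. -/
noncomputable def evalUnits (R : Type*) [CommRing R] [Algebra R A] (u : α → Aˣ) :
    MonoidAlgebra R (FreeGroup α) →ₐ[R] A :=
  MonoidAlgebra.lift R A (FreeGroup α) ((Units.coeHom A).comp (FreeGroup.lift u))

@[simp] lemma evalUnits_of (u : α → Aˣ) (w : FreeGroup α) :
    evalUnits R u (MonoidAlgebra.of R _ w) = (FreeGroup.lift u w : Aˣ) := by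
  simp [evalUnits]

/-- The fundamental formula of Fox calculus. -/
lemma evalUnits_eq_add_sum [Fintype α] [DecidableEq α] (u : α → Aˣ) (a : α → A)
    (hu : ∀ s, (u s : A) = 1 + a s) (f : MonoidAlgebra R (FreeGroup α)) :
    evalUnits R u f = algebraMap R A (magnusCoeff R [] f) +
      ∑ s, evalUnits R u (foxDeriv R s f) * a s := by
  have hof (t : α) : evalUnits R u (MonoidAlgebra.of R _ (FreeGroup.of t)) = 1 +
      ∑ s, evalUnits R u (foxElement R s (FreeGroup.of t)) * a s := by
    rw [Finset.sum_eq_single t (fun s _ hs => by rw [foxElement_of, if_neg (Ne.symm hs)]; simp)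
      (by simp), foxElement_of, if_pos rfl, evalUnits_of, FreeGroup.lift_apply_of, hu, map_one,
      one_mul]
  have key (w : FreeGroup α) : evalUnits R u (MonoidAlgebra.of R _ w) = 1 +
      ∑ s, evalUnits R u (foxElement R s w) * a s := by
    induction w using FreeGroup.induction_on with
    | C1 => rw [map_one, map_one]; simp
    | of t => exact hof t
    | inv_of t ih =>
      simp only [foxElement_inv, map_neg, map_mul, neg_mul, mul_assoc, Finset.sum_neg_distrib,
        ← Finset.mul_sum]
      rw [← sub_eq_iff_eq_add'.2 ih, mul_sub, mul_one, ← map_mul, ← map_mul, inv_mul_cancel,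
        map_one, map_one]
      abel
    | mul x y hx hy =>
      simp only [foxElement_mul, map_add, map_mul, add_mul, mul_assoc, Finset.sum_add_distrib,
        ← Finset.mul_sum]
      rw [← sub_eq_iff_eq_add'.2 hx, ← sub_eq_iff_eq_add'.2 hy, mul_sub, mul_one]
      abel
  induction f using MonoidAlgebra.induction_on with
  | of w =>
    simp only [foxDeriv_of, key w, magnusCoeff_nil]
    simp
  | add x y hx hy =>
    rw [map_add, hx, hy]
    simp only [map_add, add_mul, Finset.sum_add_distrib]
    abel
  | smul r x hx =>
    rw [map_smul, hx]
    simp only [map_smul, smul_add, smul_mul_assoc, Finset.smul_sum, smul_eq_mul, map_mul]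
    rw [Algebra.smul_def]

end FoxCalculus

/-! ### Words and their values in a free submonoid -/

/-- The sum of the values of `γ` along a word, read from right to left. -/
def wordSum {α G : Type*} [AddMonoid G] (γ : α → G) : List α → G
  | [] => 0
  | s :: l => wordSum γ l + γ s

/-- The product of the values of `a` along a word, read from right to left. -/
def wordProd {α A : Type*} [Monoid A] (a : α → A) : List α → A
  | [] => 1
  | s :: l => wordProd a l * a s

lemma wordSum_append {α G : Type*} [AddMonoid G] (γ : α → G) (l₁ l₂ : List α) :
    wordSum γ (l₁ ++ l₂) = wordSum γ l₂ + wordSum γ l₁ := by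
  induction l₁ with
  | nil => simp [wordSum]
  | cons s l ih => rw [List.cons_append, wordSum, ih, wordSum, add_assoc]

lemma List.eq_of_forall_append_append_comm {α : Type*} [Nontrivial α] {l₁ l₂ : List α}
    (h : ∀ p, l₁ ++ (p ++ l₂) = l₂ ++ (p ++ l₁)) : l₁ = l₂ := by
  wlog hle : l₁.length ≤ l₂.length generalizing l₁ l₂
  · exact (this (fun p => (h p).symm) (le_of_not_ge hle)).symm
  rcases hle.eq_or_lt with heq | hlt
  · exact (List.append_inj (h []) heq).1
  -- With the inserted word `[t]`, the two sides differ at position `l₁.length`.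
  · obtain ⟨t, ht⟩ := exists_ne l₂[l₁.length]
    have := congrArg (fun l => l[l₁.length]?) (h [t])
    simp [List.getElem?_append_left hlt, List.getElem?_eq_getElem hlt] at this
    exact absurd this ht

/-- Moving the central `c` past any word p shows that l₁ p l₂ and l₂ p l₁ have the same value, hence
are the same word. -/
lemma eq_of_central_add_wordSum {α G : Type*} [Nontrivial α] [AddMonoid G] {γ : α → G}
    (hγ : Function.Injective (wordSum γ)) {c : G} (hc : ∀ x, c + x = x + c) {l₁ l₂ : List α}
    (h : c + wordSum γ l₁ = wordSum γ l₂) : l₁ = l₂ := by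
  refine List.eq_of_forall_append_append_comm fun p => hγ ?_
  rw [wordSum_append, wordSum_append, wordSum_append, wordSum_append, ← h, add_assoc, hc,
    add_assoc, add_assoc, ← hc (wordSum γ l₁), ← add_assoc c (wordSum γ p), hc (wordSum γ p),
    add_assoc]

lemma FreelyGenerateFreeMonoid.injective_wordSum {G : Type*} [AddMonoid G] {g h : G}
    (hgh : FreelyGenerateFreeMonoid g h) : Function.Injective (wordSum ![g, h]) := by
  have key (l : List (Fin 2)) : wordSum ![g, h] l =
      FreeAddMonoid.lift ![g, h] (FreeAddMonoid.ofList l.reverse) := by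
    induction l with
    | nil => rfl
    | cons s l ih =>
      rw [wordSum, ih, List.reverse_cons, FreeAddMonoid.ofList_append, map_add]
      simp
  intro l₁ l₂ h
  rw [key, key] at h
  exact List.reverse_injective (FreeAddMonoid.ofList.injective (hgh h))

/-- Each letter is encoded by a block of two letters, and blocks of constant length decode uniquely.
-/
lemma injective_wordSum_add_swap {G : Type*} [AddMonoid G] {γ : Fin 2 → G}
    (hγ : Function.Injective (wordSum γ)) :
    Function.Injective (wordSum fun s => γ s + γ (s + 1)) := by
  let E : List (Fin 2) → List (Fin 2) := fun l => l.flatMap fun s => [s + 1, s]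
  have hE (l : List (Fin 2)) : wordSum (fun s => γ s + γ (s + 1)) l = wordSum γ (E l) := by
    induction l with
    | nil => rfl
    | cons s l ih => rw [wordSum, ih]; simp [E, wordSum, add_assoc]
  have hinj : Function.Injective E := by
    intro l₁ l₂ h
    induction l₁ generalizing l₂ with
    | nil => cases l₂ with
      | nil => rfl
      | cons t l => simp [E] at h
    | cons s l ih => cases l₂ with
      | nil => simp [E] at h
      | cons t l' =>
        simp only [E, List.flatMap_cons, List.cons_append, List.nil_append, List.cons.injEq] at h
        rw [h.2.1, ih h.2.2]
  intro l₁ l₂ h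
  rw [hE, hE] at h
  exact hinj (hγ h)

lemma injective_wordSum_neg {α G : Type*} [AddGroup G] {γ : α → G}
    (hγ : Function.Injective (wordSum γ)) : Function.Injective (wordSum fun s => -γ s) := by
  have key (l : List α) : wordSum (fun s => -γ s) l = -wordSum γ l.reverse := by
    induction l with
    | nil => simp [wordSum]
    | cons s l ih => simp [wordSum, ih, wordSum_append]
  intro l₁ l₂ h
  rw [key, key, neg_inj] at h
  exact List.reverse_injective (hγ h)

/-! ### Positive and comparable free generators -/

section Ordered

variable {G : Type*} [AddGroup G] [LinearOrder G] [AddLeftMono G] [AddRightMono G]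

lemma exists_pos_injective_wordSum {γ : Fin 2 → G} (hγ : Function.Injective (wordSum γ)) :
    ∃ γ' : Fin 2 → G, Function.Injective (wordSum γ') ∧ ∀ s, 0 < γ' s := by
  have hcomm {x y : G} (h : 0 < x + y) : 0 < y + x := by
    rwa [← neg_lt_iff_pos_add', neg_lt_iff_pos_add]
  have hneg {x y : G} (h : 0 < -(x + y)) : 0 < -(y + x) := by
    rw [neg_add_rev] at h ⊢
    exact hcomm h
  have hne : γ 0 + γ 1 ≠ 0 := fun h => by
    have : wordSum γ [1, 0] = wordSum γ [] := by simpa [wordSum] using h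
    simpa using hγ this
  rcases hne.lt_or_gt with h | h
  · have h' : 0 < -(γ 0 + γ 1) := neg_pos.2 h
    refine ⟨_, injective_wordSum_neg (injective_wordSum_add_swap hγ), fun s => ?_⟩
    fin_cases s
    · exact h'
    · exact hneg h'
  · refine ⟨_, injective_wordSum_add_swap hγ, fun s => ?_⟩
    fin_cases s
    · exact h
    · exact hcomm h

/-- For positive x and y, x + y ≤ y + (x + y) + x = 2(y + x). So the two sums are within a factor 2
of each other, and μ is the smaller one. -/
lemma exists_comparable_injective_wordSum {γ : Fin 2 → G} (hγ : Function.Injective (wordSum γ)) :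
    ∃ (γ' : Fin 2 → G) (μ : G), Function.Injective (wordSum γ') ∧ 0 < μ ∧
      ∀ s, μ ≤ γ' s ∧ γ' s ≤ 2 • μ := by
  obtain ⟨δ, hδ, hpos⟩ := exists_pos_injective_wordSum hγ
  have hle (x y : G) (hx : 0 < x) (hy : 0 < y) : x + y ≤ 2 • (y + x) := by
    rw [two_nsmul]
    calc x + y ≤ y + (x + y) := le_add_of_nonneg_left hy.le
      _ ≤ y + (x + y) + x := le_add_of_nonneg_right hx.le
      _ = y + x + (y + x) := by simp only [add_assoc]
  have hself (x : G) (hx : 0 < x) : x ≤ 2 • x := by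
    rw [two_nsmul]; exact le_add_of_nonneg_left hx.le
  have h0 := hpos 0
  have h1 := hpos 1
  rcases le_total (δ 0 + δ 1) (δ 1 + δ 0) with h | h
  · refine ⟨_, δ 0 + δ 1, injective_wordSum_add_swap hδ, add_pos h0 h1, fun s => ?_⟩
    fin_cases s
    · exact ⟨le_rfl, hself _ (add_pos h0 h1)⟩
    · exact ⟨h, hle _ _ h1 h0⟩
  · refine ⟨_, δ 1 + δ 0, injective_wordSum_add_swap hδ, add_pos h1 h0, fun s => ?_⟩
    fin_cases s
    · exact ⟨h, hle _ _ h0 h1⟩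
    · exact ⟨le_rfl, hself _ (add_pos h1 h0)⟩

lemma wordSum_le_nsmul {α : Type*} {γ : α → G} {c : G} (h : ∀ s, γ s ≤ c) (l : List α) :
    wordSum γ l ≤ l.length • c := by
  induction l with
  | nil => simp [wordSum]
  | cons s l ih =>
    rw [wordSum, List.length_cons, succ_nsmul]
    exact add_le_add ih (h s)

end Ordered

open FoxCalculus

namespace RingValuation

/-! ### Elementary properties of valuations -/

section Basic

variable {R G ι : Type*} [Ring R] [AddGroup G] [LinearOrder G] (v : RingValuation R G)

protected lemma map_zero : v.toFun 0 = ⊤ := (v.map_eq_top_iff 0).2 rfl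

lemma exists_coe_eq {x : R} (hx : x ≠ 0) : ∃ γ : G, (γ : WithTop G) = v.toFun x :=
  WithTop.ne_top_iff_exists.1 fun h => hx ((v.map_eq_top_iff x).1 h)

lemma central_of_map_algebraMap (hv : Function.Surjective v.toFun) {O : Type*} [CommRing O]
    [Algebra O R] {c : O} {γ : G} (hc : v.toFun (algebraMap O R c) = γ) (x : G) :
    γ + x = x + γ := by
  obtain ⟨d, hd⟩ := hv x
  rw [← WithTop.coe_inj, WithTop.coe_add, WithTop.coe_add, ← hc, ← hd, ← v.map_mul, ← v.map_mul,
    Algebra.commutes]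

lemma le_map_sum {s : Finset ι} {x : ι → R} {c : WithTop G} (h : ∀ i ∈ s, c ≤ v.toFun (x i)) :
    c ≤ v.toFun (∑ i ∈ s, x i) := by
  induction s using Finset.cons_induction with
  | empty => rw [Finset.sum_empty, v.map_zero]; exact le_top
  | cons i s hi ih =>
    rw [Finset.sum_cons]
    exact (le_min (h i (Finset.mem_cons_self i s))
      (ih fun j hj => h j (Finset.mem_cons_of_mem hj))).trans (v.min_le_map_add _ _)

lemma lt_map_sum {s : Finset ι} {x : ι → R} {c : WithTop G} (hc : c < ⊤)
    (h : ∀ i ∈ s, c < v.toFun (x i)) : c < v.toFun (∑ i ∈ s, x i) := by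
  induction s using Finset.cons_induction with
  | empty => rwa [Finset.sum_empty, v.map_zero]
  | cons i s hi ih =>
    rw [Finset.sum_cons]
    exact (lt_min (h i (Finset.mem_cons_self i s))
      (ih fun j hj => h j (Finset.mem_cons_of_mem hj))).trans_le (v.min_le_map_add _ _)

variable [Nontrivial R] [AddLeftMono G]

protected lemma map_one : v.toFun 1 = 0 := by
  obtain ⟨γ, hγ⟩ := v.exists_coe_eq one_ne_zero
  have h := v.map_mul 1 1
  rw [mul_one, ← hγ, ← WithTop.coe_add, WithTop.coe_inj, left_eq_add] at h
  rw [← hγ, h, WithTop.coe_zero]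

protected lemma map_neg (x : R) : v.toFun (-x) = v.toFun x := by
  have h1 : v.toFun (-1) = 0 := by
    obtain ⟨γ, hγ⟩ := v.exists_coe_eq (neg_ne_zero.2 (one_ne_zero (α := R)))
    have h := v.map_mul (-1) (-1)
    rw [neg_mul_neg, mul_one, v.map_one, ← hγ, ← WithTop.coe_add, ← WithTop.coe_zero,
      WithTop.coe_inj] at h
    rw [← hγ, ← WithTop.coe_zero, WithTop.coe_inj]
    -- An ordered group has no 2-torsion.
    rcases lt_trichotomy γ 0 with h0 | h0 | h0
    · exact absurd h.symm (add_neg h0 h0).ne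
    · exact h0
    · exact absurd h (add_pos h0 h0).ne
  rw [← neg_one_mul, v.map_mul, h1, zero_add]

/-- If the nonzero terms of a finite sum have distinct values, then the value of the sum is at
most the value of each term. -/
lemma map_sum_le {s : Finset ι} {x : ι → R}
    (h : ∀ i ∈ s, ∀ j ∈ s, x i ≠ 0 → v.toFun (x i) = v.toFun (x j) → i = j) {i : ι} (hi : i ∈ s) :
    v.toFun (∑ i ∈ s, x i) ≤ v.toFun (x i) := by
  classical
  obtain ⟨j, hj, hmin⟩ := s.exists_min_image (fun i => v.toFun (x i)) ⟨i, hi⟩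
  refine le_trans ?_ (hmin i hi)
  by_cases hxj : x j = 0
  · rw [hxj, v.map_zero]; exact le_top
  have htop : v.toFun (x j) < ⊤ := lt_top_iff_ne_top.2 fun h => hxj ((v.map_eq_top_iff _).1 h)
  have hrest : v.toFun (x j) < v.toFun (∑ i ∈ s.erase j, x i) := v.lt_map_sum htop fun i hi' =>
    (hmin i (Finset.mem_of_mem_erase hi')).lt_of_ne fun he =>
      Finset.ne_of_mem_erase hi' (h j hj i (Finset.mem_of_mem_erase hi') hxj he).symm
  -- Otherwise `x j`, the whole sum minus the rest, would have value larger than its own.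
  by_contra hlt
  have h2 := (lt_min (not_le.1 hlt) (hrest.trans_eq (v.map_neg _).symm)).trans_le
    (v.min_le_map_add _ _)
  rw [← Finset.add_sum_erase s x hj, add_neg_cancel_right] at h2
  exact lt_irrefl _ h2

lemma map_wordProd {α : Type*} {a : α → R} {γ : α → G} (h : ∀ s, v.toFun (a s) = γ s)
    (l : List α) : v.toFun (wordProd a l) = wordSum γ l := by
  induction l with
  | nil => exact v.map_one
  | cons s l ih => rw [wordProd, v.map_mul, ih, h, wordSum, WithTop.coe_add]

lemma map_units_eq_zero {α : Type*} {u : α → Rˣ} (hu : ∀ s, v.toFun (u s) = 0)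
    (w : FreeGroup α) : v.toFun (FreeGroup.lift u w : Rˣ) = 0 := by
  induction w using FreeGroup.induction_on with
  | C1 => rw [map_one, Units.val_one, v.map_one]
  | of t => rw [FreeGroup.lift_apply_of, hu]
  | inv_of t _ =>
    have h := v.map_mul (u t) (u t)⁻¹.val
    rw [Units.mul_inv, v.map_one, hu, zero_add] at h
    rw [map_inv, FreeGroup.lift_apply_of, ← h]
  | mul x y hx hy => rw [_root_.map_mul, Units.val_mul, v.map_mul, hx, hy, add_zero]

end Basic

/-! ### Truncated Magnus expansions and injectivity -/

section Approximation

variable {D G O α : Type*} [Ring D] [Nontrivial D] [AddGroup G] [LinearOrder G] [AddLeftMono G]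
  (v : RingValuation D G) [CommRing O] [Algebra O D]

lemma zero_le_map_evalUnits (hO : ∀ c : O, 0 ≤ v.toFun (algebraMap O D c)) {u : α → Dˣ}
    (hu : ∀ s, v.toFun (u s) = 0) (f : MonoidAlgebra O (FreeGroup α)) :
    0 ≤ v.toFun (evalUnits O u f) := by
  rw [evalUnits, MonoidAlgebra.lift_apply']
  refine v.le_map_sum fun w _ => ?_
  rw [v.map_mul]
  exact add_nonneg (hO _) (v.map_units_eq_zero hu w).ge

variable [AddRightMono G]

/-- The value of an element of the group algebra of the free group is approximated by the
truncations of its Magnus expansion. -/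
lemma exists_nsmul_le_map_evalUnits_sub [Fintype α] [DecidableEq α]
    (hO : ∀ c : O, 0 ≤ v.toFun (algebraMap O D c)) {u : α → Dˣ} (hu : ∀ s, v.toFun (u s) = 0)
    {a : α → D} (hua : ∀ s, (u s : D) = 1 + a s) {μ : G} (hμ : ∀ s, (μ : WithTop G) ≤ v.toFun (a s))
    (n : ℕ) (f : MonoidAlgebra O (FreeGroup α)) :
    ∃ p : List α →₀ O, (∀ l : List α, l.length < n → p l = magnusCoeff O l f) ∧
      ((n • μ : G) : WithTop G) ≤ v.toFun (evalUnits O u f -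
        p.sum fun l c => algebraMap O D c * wordProd a l) := by
  induction n generalizing f with
  | zero =>
    refine ⟨0, fun l hl => absurd hl (Nat.not_lt_zero _), ?_⟩
    rw [zero_nsmul, Finsupp.sum_zero_index, sub_zero]
    exact v.zero_le_map_evalUnits hO hu f
  | succ n ih =>
    choose p hp hle using fun s => ih (foxDeriv O s f)
    -- The fundamental formula dictates the witness: the augmentation, plus the truncations of the
    -- derivatives along each `s` multiplied on the right by `a s`, which puts `s` at the head of
    -- the list. The factor `a s` raises the error by at least μ.
    refine ⟨Finsupp.single [] (magnusCoeff O [] f) +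
      ∑ s, (p s).mapDomain (List.cons s), fun l hl => ?_, ?_⟩
    · rw [Finsupp.add_apply, Finsupp.finsetSum_apply]
      cases l with
      | nil =>
        rw [Finsupp.single_eq_same, Finset.sum_eq_zero, add_zero]
        intro s _
        exact Finsupp.mapDomain_of_notMem_range _ _ (by simp)
      | cons t l =>
        rw [Finsupp.single_eq_of_ne (by simp), zero_add, Finset.sum_eq_single t,
          Finsupp.mapDomain_apply List.cons_injective, magnusCoeff_cons]
        · exact hp t l (by simpa using hl)
        · intro s _ hs
          exact Finsupp.mapDomain_of_notMem_range _ _ (by simp [hs])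
        · simp
    · have hsum : ((Finsupp.single [] (magnusCoeff O [] f) +
            ∑ s, (p s).mapDomain (List.cons s)).sum fun l c => algebraMap O D c * wordProd a l) =
          algebraMap O D (magnusCoeff O [] f) +
            ∑ s, ((p s).sum fun l c => algebraMap O D c * wordProd a l) * a s := by
        have h0 (l : List α) : algebraMap O D 0 * wordProd a l = 0 := by rw [map_zero, zero_mul]
        have hadd (l : List α) (b c : O) : algebraMap O D (b + c) * wordProd a l =
            algebraMap O D b * wordProd a l + algebraMap O D c * wordProd a l := by
          rw [map_add, add_mul]
        rw [Finsupp.sum_add_index' h0 hadd, Finsupp.sum_single_index (h0 _), wordProd, mul_one,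
          ← Finsupp.sum_finsetSum_index h0 hadd]
        congr 1
        refine Finset.sum_congr rfl fun s _ => ?_
        rw [Finsupp.sum_mapDomain_index h0 hadd, Finsupp.sum_mul]
        simp only [wordProd, mul_assoc]
      rw [hsum, evalUnits_eq_add_sum u a hua f, add_sub_add_left_eq_sub, ← Finset.sum_sub_distrib]
      refine v.le_map_sum fun s _ => ?_
      rw [← sub_mul, v.map_mul, succ_nsmul, WithTop.coe_add]
      exact add_le_add (hle s) (hμ s)

lemma evalUnits_ne_zero_of_map_magnusCoeff [Fintype α] [DecidableEq α] [Nontrivial α]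
    (hv : Function.Surjective v.toFun)
    (hO : ∀ c : O, 0 ≤ v.toFun (algebraMap O D c)) {u : α → Dˣ} (hu : ∀ s, v.toFun (u s) = 0)
    {a : α → D} (hua : ∀ s, (u s : D) = 1 + a s) {γ : α → G} (hγ : ∀ s, v.toFun (a s) = γ s)
    (hinj : Function.Injective (wordSum γ)) {μ : G} (hμ : 0 < μ)
    (hμγ : ∀ s, μ ≤ γ s ∧ γ s ≤ 2 • μ) {f : MonoidAlgebra O (FreeGroup α)} {l : List α}
    (hl : v.toFun (algebraMap O D (magnusCoeff O l f)) = 0) : evalUnits O u f ≠ 0 := by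
  intro hf
  -- The value of the word `l` is at most 2|l|μ, so 2|l| + 1 is the first length at which the error
  -- bound exceeds it.
  obtain ⟨p, hp, hle⟩ := v.exists_nsmul_le_map_evalUnits_sub hO hu hua
    (fun s => (WithTop.coe_le_coe.2 (hμγ s).1).trans (hγ s).ge) (2 * l.length + 1) f
  have hpl : p l = magnusCoeff O l f := hp l (by omega)
  have hlp : l ∈ p.support := by
    rw [Finsupp.mem_support_iff, hpl]
    intro h
    rw [h, map_zero, v.map_zero] at hl
    exact WithTop.top_ne_zero hl
  rw [hf, zero_sub, v.map_neg] at hle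
  have hval (i : List α) : v.toFun (algebraMap O D (p i) * wordProd a i) =
      v.toFun (algebraMap O D (p i)) + wordSum γ i := by
    rw [v.map_mul, v.map_wordProd hγ]
  have h2 : v.toFun (p.sum fun l c => algebraMap O D c * wordProd a l) ≤ wordSum γ l := by
    refine (v.map_sum_le (fun i _ j _ hi0 hij => ?_) hlp).trans_eq ?_
    · beta_reduce at hi0 hij
      have hj0 : algebraMap O D (p j) * wordProd a j ≠ 0 := fun h => by
        rw [h, v.map_zero, v.map_eq_top_iff] at hij
        exact hi0 hij
      obtain ⟨c, hc⟩ := v.exists_coe_eq (left_ne_zero_of_mul hi0)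
      obtain ⟨d, hd⟩ := v.exists_coe_eq (left_ne_zero_of_mul hj0)
      have hdc := v.central_of_map_algebraMap hv hd.symm
      have hcc := v.central_of_map_algebraMap hv hc.symm
      rw [hval, hval, ← hc, ← hd, ← WithTop.coe_add, ← WithTop.coe_add, WithTop.coe_inj] at hij
      -- Equal values of two terms make their words differ by `-d + c`, which is central because `c`
      -- and `d` are values of scalars.
      refine eq_of_central_add_wordSum hinj (c := -d + c) (fun x => ?_) ?_
      · have h1 : -d + x = x + -d := by
          rw [neg_add_eq_iff_eq_add, ← add_assoc, hdc, add_neg_cancel_right]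
        rw [add_assoc, hcc, ← add_assoc, h1, add_assoc]
      · rw [add_assoc, hij, neg_add_cancel_left]
    · rw [hval, hpl, hl, zero_add]
  have h3 := WithTop.coe_le_coe.1 (hle.trans h2)
  have h4 := h3.trans (wordSum_le_nsmul (fun s => (hμγ s).2) l)
  rw [← mul_nsmul, succ_nsmul] at h4
  exact absurd h4 (not_le.2 (lt_add_of_pos_right _ hμ))

lemma evalUnits_ne_zero_of_map_coeff [Fintype α] [DecidableEq α] [Nontrivial α]
    (hv : Function.Surjective v.toFun)
    (hO : ∀ c : O, 0 ≤ v.toFun (algebraMap O D c)) {u : α → Dˣ} (hu : ∀ s, v.toFun (u s) = 0)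
    {a : α → D} (hua : ∀ s, (u s : D) = 1 + a s) {γ : α → G} (hγ : ∀ s, v.toFun (a s) = γ s)
    (hinj : Function.Injective (wordSum γ)) {μ : G} (hμ : 0 < μ)
    (hμγ : ∀ s, μ ≤ γ s ∧ γ s ≤ 2 • μ) {f : MonoidAlgebra O (FreeGroup α)} {w : FreeGroup α}
    (hw : v.toFun (algebraMap O D (f.coeff w)) = 0) : evalUnits O u f ≠ 0 := by
  let I : Ideal O :=
    { carrier := {c | 0 < v.toFun (algebraMap O D c)}
      zero_mem' := by
        change 0 < v.toFun (algebraMap O D 0)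
        rw [map_zero, v.map_zero]
        exact WithTop.coe_lt_top 0
      add_mem' := fun {b c} hb hc => by
        change 0 < v.toFun (algebraMap O D (b + c))
        rw [map_add]
        exact (lt_min hb hc).trans_le (v.min_le_map_add _ _)
      smul_mem' := fun b c hc => by
        change 0 < v.toFun (algebraMap O D (b * c))
        rw [_root_.map_mul, v.map_mul]
        exact lt_of_lt_of_le hc (le_add_of_nonneg_left (hO b)) }
  -- If every Magnus coefficient lay in `I`, so would the coefficient of f at `w`, which has value
  -- 0.
  obtain ⟨l, hl⟩ : ∃ l, magnusCoeff O l f ∉ I := by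
    by_contra! h
    exact absurd hw (ne_of_gt (coeff_mem_of_magnusCoeff_mem I f h w))
  exact v.evalUnits_ne_zero_of_map_magnusCoeff hv hO hu hua hγ hinj hμ hμγ
    (le_antisymm (not_lt.1 hl) (hO _))

/-- The elements of `k` whose image in `D` has nonnegative value. -/
def integers (k : Type*) [Field k] [Algebra k D] : Subring k where
  carrier := {c | 0 ≤ v.toFun (algebraMap k D c)}
  zero_mem' := by
    change 0 ≤ v.toFun (algebraMap k D 0)
    rw [map_zero, v.map_zero]
    exact le_top
  one_mem' := by
    change 0 ≤ v.toFun (algebraMap k D 1)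
    rw [map_one, v.map_one]
  add_mem' {b c} hb hc := by
    change 0 ≤ v.toFun (algebraMap k D (b + c))
    rw [map_add]
    exact (le_min hb hc).trans (v.min_le_map_add _ _)
  neg_mem' {c} hc := by
    change 0 ≤ v.toFun (algebraMap k D (-c))
    rw [map_neg, v.map_neg]
    exact hc
  mul_mem' {b c} hb hc := by
    change 0 ≤ v.toFun (algebraMap k D (b * c))
    rw [_root_.map_mul, v.map_mul]
    exact add_nonneg hb hc

/-- Dividing a nonzero f by a coefficient of least value makes all its coefficients integral and one
of them 1, so it comes from the group algebra over `v.integers k`. -/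
lemma injective_evalUnits [Fintype α] [DecidableEq α] [Nontrivial α]
    (hv : Function.Surjective v.toFun) {k : Type*} [Field k] [Algebra k D]
    {u : α → Dˣ} (hu : ∀ s, v.toFun (u s) = 0)
    {a : α → D} (hua : ∀ s, (u s : D) = 1 + a s) {γ : α → G} (hγ : ∀ s, v.toFun (a s) = γ s)
    (hinj : Function.Injective (wordSum γ)) {μ : G} (hμ : 0 < μ)
    (hμγ : ∀ s, μ ≤ γ s ∧ γ s ≤ 2 • μ) : Function.Injective (evalUnits k u) := by
  rw [injective_iff_map_eq_zero]
  intro f hf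
  by_contra hne
  have hsupp : f.coeff.support.Nonempty := by
    rw [Finsupp.support_nonempty_iff]
    intro h
    exact hne (by ext w; simp [h])
  obtain ⟨w, hw, hmin⟩ :=
    f.coeff.support.exists_min_image (fun w => v.toFun (algebraMap k D (f.coeff w))) hsupp
  have hc : f.coeff w ≠ 0 := Finsupp.mem_support_iff.1 hw
  have hint (x : FreeGroup α) : (f.coeff w)⁻¹ * f.coeff x ∈ v.integers k := by
    change 0 ≤ v.toFun (algebraMap k D _)
    by_cases hx : x ∈ f.coeff.support
    · calc (0 : WithTop G) = v.toFun (algebraMap k D ((f.coeff w)⁻¹ * f.coeff w)) := by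
            rw [inv_mul_cancel₀ hc, map_one, v.map_one]
        _ ≤ _ := by
            rw [_root_.map_mul, _root_.map_mul, v.map_mul, v.map_mul]
            exact add_le_add le_rfl (hmin x hx)
    · rw [Finsupp.notMem_support_iff.1 hx, mul_zero, map_zero, v.map_zero]
      exact le_top
  obtain ⟨f', hf'⟩ : ∃ f' : MonoidAlgebra (v.integers k) (FreeGroup α),
      MonoidAlgebra.mapRingHom _ (algebraMap (v.integers k) k) f' = (f.coeff w)⁻¹ • f := by
    have : (f.coeff w)⁻¹ • f ∈ Set.range (MonoidAlgebra.map (M := FreeGroup α)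
        (algebraMap (v.integers k) k : v.integers k →+ k)) := by
      rw [MonoidAlgebra.range_map]
      exact fun x => ⟨⟨_, hint x⟩, rfl⟩
    exact this
  refine v.evalUnits_ne_zero_of_map_coeff (O := v.integers k) hv (fun c => c.2) hu hua hγ hinj hμ hμγ
    (f := f') (w := w) ?_ ?_
  · have h : algebraMap (v.integers k) k (f'.coeff w) = 1 := by
      rw [← MonoidAlgebra.coeff_mapRingHom, hf']
      exact inv_mul_cancel₀ hc
    rw [IsScalarTower.algebraMap_apply (v.integers k) k D, h, map_one, v.map_one]
  · rw [evalUnits, ← MonoidAlgebra.lift_mapRingHom_algebraMap (R := v.integers k) (S := k), hf']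
    change evalUnits k u _ = 0
    rw [map_smul, hf, smul_zero]

end Approximation

end RingValuation

/-- The two invariance assumptions say that `G` is an ordered group (the order is invariant under
left and right translations). For a field `k`, an algebra structure `Algebra k D` on the division
ring `D` is the same as an identification of `k` with a subfield of `D` contained in its center. -/
theorem corollary4p4 {D : Type*} [DivisionRing D]
    {G : Type*} [AddGroup G] [LinearOrder G] [AddLeftStrictMono G] [AddRightStrictMono G]
    (v : RingValuation D G) (hv : Function.Surjective v.toFun)
    (g h : G) (hgh : FreelyGenerateFreeMonoid g h)
    (k : Type*) [Field k] [Algebra k D] :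
    ContainsFreeGroupAlgebra k D := by
  have : AddLeftMono G := addLeftMono_of_addLeftStrictMono G
  have : AddRightMono G := addRightMono_of_addRightStrictMono G
  obtain ⟨γ, μ, hinj, hμ, hμγ⟩ := exists_comparable_injective_wordSum hgh.injective_wordSum
  choose a ha using fun s => hv (γ s : WithTop G)
  have hval (s : Fin 2) : v.toFun (1 + a s) = 0 := by
    have hpos : v.toFun 1 < v.toFun (a s) := by
      rw [v.map_one, ha]
      exact WithTop.coe_lt_coe.2 (hμ.trans_le (hμγ s).1)
    refine le_antisymm ?_ ?_
    · by_contra hlt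
      rw [← v.map_one] at hlt
      have := (lt_min (not_le.1 hlt) (hpos.trans_eq (v.map_neg _).symm)).trans_le
        (v.min_le_map_add _ _)
      rw [add_neg_cancel_right] at this
      exact lt_irrefl _ this
    · rw [← v.map_one]
      exact (le_min le_rfl hpos.le).trans (v.min_le_map_add _ _)
  have hne (s : Fin 2) : 1 + a s ≠ 0 := fun h0 => by
    have := hval s
    rw [h0, v.map_zero] at this
    exact WithTop.top_ne_zero this
  exact ⟨evalUnits k fun s => Units.mk0 _ (hne s),
    v.injective_evalUnits hv hval (fun _ => rfl) ha hinj hμ hμγ⟩
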